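/- Let $\mathscr H$ be a complex Hilbert space with an orthonormal basis $(e_i)_{i\in I}$, let $\mathscr H\otimes\mathscr H$ be the Hilbert space tensor product, let $U:\mathscr H\to\mathscr H\otimes\mathscr H$ be the isometry with $Ue_i=e_i\otimes e_i$ for all $i\in I$, and for bounded linear operators $A,B$ on $\mathscr H$ let $A\circ B=U^*(A\otimes B)U$ be their Hadamard product. For positive invertible $A,B$ and $\alpha\in[0,1]$ put $$A\sharp_\alpha B=A^{1/2}\left(A^{-1/2}BA^{-1/2}\right)^{\alpha}A^{1/2},\qquad A\sharp B=A\sharp_{1/2}B,$$ and for self-adjoint operators write $X\le Y$ if $\langle (Y-X)x,x\rangle\ge0$ for all $x\in\mathscr H$. Let $A_1,\dots,A_n,B_1,\dots,B_n$ be positive invertible bounded linear operators on $\mathscr H$, let $s,t$ be real numbers with either $1\ge t\ge s>\frac12$ or $0\le t\le s<\frac12$, and let $r'=\min\left\{\frac{t-s}{t-1/2},\frac{s-1/2}{t-1/2}\right\}$. Then $$\begin{aligned} &\sum_{j=1}^n(A_j\sharp_{s}B_j)\circ \sum_{j=1}^n(A_j\sharp_{1-s}B_j)\\ &\quad+\frac{t-s}{t-1/2}\Big(\sum_{j=1}^n(A_j\sharp_{s}B_j)\circ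 \sum_{j=1}^n(A_j\sharp_{1-s}B_j)-\sum_{j=1}^n(A_j\sharp B_j)\circ \sum_{j=1}^n(A_j\sharp B_j)\Big)\\ &\quad+r'\Big(\sum_{j=1}^n(A_j\sharp_{s}B_j)\circ \sum_{j=1}^n(A_j\sharp_{1-s}B_j)+\sum_{j=1}^n(A_j\sharp B_j)\circ \sum_{j=1}^n(A_j\sharp B_j)\\ &\qquad\qquad-2\sum_{j=1}^n(A_j\sharp_{\frac{3-2s}{4}}B_j)\circ \sum_{j=1}^n(A_j\sharp_{\frac{1+2s}{4}}B_j)\Big)\\ &\le \sum_{j=1}^n(A_j\sharp_{t}B_j)\circ \sum_{j=1}^n(A_j\sharp_{1-t} B_j), \end{aligned}$$ where each $\sum_j X_j\circ\sum_j Y_j$ denotes the Hadamard product $\big(\sum_j X_j\big)\circ\big(\sum_j Y_j\big)$ of the two sums. -/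

import Mathlib

open scoped TensorProduct

noncomputable section

namespace Callebaut

section HilbertTensor

variable {H : Type*} [NormedAddCommGroup H] [InnerProductSpace ℂ H]

/-- The Hilbert space tensor product `H ⊗ H`: the completion of the algebraic tensor product for
the inner product determined by `⟪x ⊗ y, x' ⊗ y'⟫ = ⟪x, x'⟫ * ⟪y, y'⟫`. -/
abbrev HilbertTensor (H : Type*) [NormedAddCommGroup H] [InnerProductSpace ℂ H] : Type _ :=
  UniformSpace.Completion (H ⊗[ℂ] H)

/-- The elementary tensor `x ⊗ y` in the Hilbert space tensor product. -/
def tmul (x y : H) : HilbertTensor H := ((x ⊗ₜ[ℂ] y : H ⊗[ℂ] H) : HilbertTensor H)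

/-- The tensor product `A ⊗ B` of two bounded operators, as a bounded operator on `H ⊗ H`. -/
def opTensor (A B : H →L[ℂ] H) : HilbertTensor H →L[ℂ] HilbertTensor H :=
  (TensorProduct.mapL A B).completion

theorem opTensor_tmul (A B : H →L[ℂ] H) (x y : H) :
    opTensor A B (tmul x y) = tmul (A x) (B y) := by
  simp [opTensor, tmul]

theorem orthonormal_diag {ι : Type*} (e : HilbertBasis ι ℂ H) :
    Orthonormal ℂ (fun i => tmul (e i) (e i)) := by
  classical
  rw [orthonormal_iff_ite]
  intro i j
  have h := orthonormal_iff_ite.mp e.orthonormal i j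
  simp only [tmul, UniformSpace.Completion.inner_coe, TensorProduct.inner_tmul, h]
  split_ifs <;> simp

/-- The isometry `U : H → H ⊗ H` with `U (e i) = e i ⊗ e i` for every vector `e i` of the
orthonormal basis `e`. -/
def diagIsometry {ι : Type*} (e : HilbertBasis ι ℂ H) : H →ₗᵢ[ℂ] HilbertTensor H :=
  (orthonormal_diag e).orthogonalFamily.linearIsometry.comp e.repr.toLinearIsometry

theorem diagIsometry_apply_basis {ι : Type*} (e : HilbertBasis ι ℂ H) (i : ι) :
    diagIsometry e (e i) = tmul (e i) (e i) := by
  classical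
  simp [diagIsometry, HilbertBasis.repr_self, OrthogonalFamily.linearIsometry_apply_single]

/-- The Hadamard product `A ∘ B = U* (A ⊗ B) U` relative to the orthonormal basis `e`. -/
def hadamard [CompleteSpace H] {ι : Type*} (e : HilbertBasis ι ℂ H) (A B : H →L[ℂ] H) : H →L[ℂ] H :=
  (diagIsometry e).toContinuousLinearMap.adjoint ∘L opTensor A B ∘L
    (diagIsometry e).toContinuousLinearMap

end HilbertTensor

section GeometricMean

variable {H : Type*} [NormedAddCommGroup H] [InnerProductSpace ℂ H] [CompleteSpace H]

/-- The weighted geometric mean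
`A ♯_α B = A^(1/2) (A^(-1/2) B A^(-1/2))^α A^(1/2)`, where the real powers of positive invertible
operators are given by the continuous functional calculus. -/
def wgmean (α : ℝ) (A B : H →L[ℂ] H) : H →L[ℂ] H :=
  A ^ (1 / 2 : ℝ) * (A ^ (-(1 / 2) : ℝ) * B * A ^ (-(1 / 2) : ℝ)) ^ α * A ^ (1 / 2 : ℝ)

/-- The geometric mean `A ♯ B = A ♯_{1/2} B`. -/
def gmean (A B : H →L[ℂ] H) : H →L[ℂ] H := wgmean (1 / 2) A B

end GeometricMean

end Callebaut

end

noncomputable section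

open NormedSpace

namespace Callebaut

/-! ### Hyperbolic inequalities for real numbers. -/

section Scalar

/-! Expand both sums and write `X_j = A_j^(-1/2) B_j A_j^(-1/2)`. The `(j, k)` term is `X_j^p ⊗
X_k^(1-p)` compressed by `(A_j^(1/2) ⊗ A_k^(1/2)) U`, an operator independent of `p`. The Hadamard
product is commutative, so the term may be averaged with the one having `p` and `1 - p` exchanged.

Put `L = log X_j ⊗ 1` and `M = 1 ⊗ log X_k`. These commute, so the average is `exp T * cosh((p -
1/2) K) * exp T` with `T = (L + M)/4` and `K = L - M` (`opTensor_rpow_add_eq_tensorCosh`,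
`hadamard_sum_wgmean`). Every Hadamard product in the theorem thus becomes a value of `cosh` at a
multiple of `K`.

What remains is the scalar inequality `cosh_refined`, with `c = (s - 1/2)/(t - 1/2)`. Functional
calculus transfers it to `K`; conjugation, compression and summation preserve the order. -/

/-- Average the tangent-line bounds for `exp` at `x` and at `-x`. -/
theorem cosh_add_mul_sinh_le_cosh (x y : ℝ) :
    Real.cosh x + (y - x) * Real.sinh x ≤ Real.cosh y := by
  have tangent (a b : ℝ) : Real.exp a * (1 + (b - a)) ≤ Real.exp b := by
    calc Real.exp a * (1 + (b - a)) ≤ Real.exp a * Real.exp (b - a) := by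
          gcongr; linarith [Real.add_one_le_exp (b - a)]
      _ = Real.exp b := by rw [← Real.exp_add]; congr 1; ring
  have h₁ := tangent x y
  have h₂ := tangent (-x) (-y)
  rw [Real.cosh_eq, Real.cosh_eq, Real.sinh_eq]
  linarith

theorem sinh_le_mul_cosh {x : ℝ} (hx : 0 ≤ x) : Real.sinh x ≤ x * Real.cosh x := by
  have hmono : MonotoneOn (fun y => y * Real.cosh y - Real.sinh y) (Set.Ici 0) := by
    refine monotoneOn_of_hasDerivWithinAt_nonneg (f' := fun y => y * Real.sinh y)
      (convex_Ici 0) (by fun_prop) (fun y _ => ?_) (fun y hy => ?_)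
    · have h := ((hasDerivAt_id y).mul (Real.hasDerivAt_cosh y)).sub (Real.hasDerivAt_sinh y)
      exact (h.congr_deriv (by simp)).hasDerivWithinAt
    · rw [interior_Ici] at hy
      exact mul_nonneg hy.le (Real.sinh_nonneg_iff.mpr hy.le)
  have h := hmono Set.self_mem_Ici hx hx
  simp at h
  linarith

theorem sinh_sq_le_mul_sinh_mul_cosh (x : ℝ) :
    Real.sinh x ^ 2 ≤ x * Real.sinh x * Real.cosh x := by
  have aux {y : ℝ} (hy : 0 ≤ y) : Real.sinh y ^ 2 ≤ y * Real.sinh y * Real.cosh y := by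
    nlinarith [mul_le_mul_of_nonneg_left (sinh_le_mul_cosh hy) (Real.sinh_nonneg_iff.mpr hy)]
  rcases le_total 0 x with hx | hx
  · exact aux hx
  · simpa using aux (neg_nonneg.mpr hx)

/-- A refined convexity inequality for `cosh` along the segment from `0` to `u`. -/
theorem cosh_refined {c r u : ℝ} (hc : 0 < c) (hc' : c ≤ 1) (hr : r ≤ 1 - c) :
    Real.cosh (c * u) + (1 - c) * (Real.cosh (c * u) - 1)
      + r * (Real.cosh (c * u) + 1 - 2 * Real.cosh (c * u / 2)) ≤ Real.cosh u := by
  obtain ⟨w, hw⟩ : ∃ w, c * u = 2 * w := ⟨c * u / 2, by ring⟩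
  have htan := cosh_add_mul_sinh_le_cosh (c * u) u
  have hws := sinh_sq_le_mul_sinh_mul_cosh w
  have hwnn : 0 ≤ w * Real.sinh w * Real.cosh w := (sq_nonneg _).trans hws
  have h1 : 1 ≤ Real.cosh w := Real.one_le_cosh w
  -- `u * sinh (c * u)` is nonnegative, so the extra factor `c ≤ 1` only decreases the left side.
  have hslope : (1 - c) * (c * u * Real.sinh (c * u)) ≤ (u - c * u) * Real.sinh (c * u) := by
    have hnn : 0 ≤ c * (u * Real.sinh (c * u)) := by
      rw [← mul_assoc, hw, Real.sinh_two_mul]; linarith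
    have hnn' : 0 ≤ u * Real.sinh (c * u) := nonneg_of_mul_nonneg_right hnn hc
    nlinarith [mul_nonneg (mul_nonneg (sub_nonneg.mpr hc') (sub_nonneg.mpr hc')) hnn']
  have hsq : Real.sinh w ^ 2 = Real.cosh w ^ 2 - 1 := by linarith [Real.cosh_sq w]
  rw [hw] at htan hslope ⊢
  rw [Real.sinh_two_mul] at htan hslope
  rw [Real.cosh_two_mul] at htan ⊢
  rw [mul_div_cancel_left₀ w two_ne_zero]
  rw [hsq] at htan hws ⊢
  -- `cosh 2w + 1 - 2 cosh w = 2 cosh w (cosh w - 1) ≥ 0`, so `r` may be raised to `1 - c`. Then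
  -- `cosh w (cosh w - 1) ≤ sinh² w ≤ w sinh w cosh w` closes the gap.
  have hr' := mul_le_mul_of_nonneg_right hr
    (mul_nonneg (by linarith : 0 ≤ Real.cosh w) (sub_nonneg.mpr h1))
  nlinarith [mul_le_mul_of_nonneg_left hws (sub_nonneg.mpr hc'),
    mul_nonneg (sub_nonneg.mpr hc') (sub_nonneg.mpr h1)]

end Scalar

/-! ### Exponentials and `cosh` in a C⋆-algebra. -/

section Exponential

theorem exp_add_of_commute_map {𝔸 𝔹 : Type*} [NormedRing 𝔸] [NormedAlgebra ℂ 𝔸] [CompleteSpace 𝔸]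
    [NormedRing 𝔹] [NormedAlgebra ℂ 𝔹] [CompleteSpace 𝔹] {f g : 𝔸 →+* 𝔹}
    (hf : Continuous f) (hg : Continuous g) {x y : 𝔸} (h : Commute (f x) (g y)) :
    f (exp x) * g (exp y) = exp (f x + g y) := by
  let +nondep : NormedAlgebra ℚ 𝔸 := .restrictScalars ℚ ℂ 𝔸
  let +nondep : NormedAlgebra ℚ 𝔹 := .restrictScalars ℚ ℂ 𝔹
  rw [exp_add_of_commute h, map_exp f hf, map_exp g hg]

variable {𝔸 : Type*} [CStarAlgebra 𝔸]

theorem exp_smul_eq_cfc {K : 𝔸} (hK : IsSelfAdjoint K) (v : ℝ) :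
    exp (v • K) = cfc (fun x : ℝ => Real.exp (v * x)) K := by
  rw [← CFC.real_exp_eq_normedSpace_exp ((IsSelfAdjoint.all v).smul hK),
    ← cfc_comp_smul v Real.exp K]
  simp only [smul_eq_mul]

/-- Conjugation of the operator `cosh (v K)` by `exp T`. -/
def coshConj (T K : 𝔸) (v : ℝ) : 𝔸 :=
  exp T * cfc (fun x : ℝ => Real.cosh (v * x)) K * exp T

theorem exp_add_exp_eq_coshConj {T K : 𝔸} (hK : IsSelfAdjoint K) (h : Commute T K) (v : ℝ) :
    exp (T + v • K + T) + exp (T + (-v) • K + T) = (2 : ℝ) • coshConj T K v := by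
  let +nondep : NormedAlgebra ℚ 𝔸 := .restrictScalars ℚ ℂ 𝔸
  have hexp (w : ℝ) : exp (T + w • K + T) = exp T * exp (w • K) * exp T := by
    have hw : Commute T (w • K) := h.smul_right w
    rw [exp_add_of_commute ((Commute.refl T).add_left hw.symm), exp_add_of_commute hw]
  rw [hexp, hexp, ← add_mul, ← mul_add, exp_smul_eq_cfc hK, exp_smul_eq_cfc hK,
    ← cfc_add K (fun x : ℝ => Real.exp (v * x)) (fun x : ℝ => Real.exp (-v * x)), coshConj,
    ← smul_mul_assoc, ← mul_smul_comm, ← cfc_smul (2 : ℝ) (fun x : ℝ => Real.cosh (v * x)) K]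
  congr 3
  ext x
  rw [Real.cosh_eq, smul_eq_mul, neg_mul]
  ring

/-- Only functions of the single element `K` are compared, so `cfc_mono` applies; conjugation by the
self-adjoint `exp T` keeps the order. If `K` is not self-adjoint, `cfc` takes its default value `0`.
-/
theorem coshConj_refined [PartialOrder 𝔸] [StarOrderedRing 𝔸] {T K : 𝔸} (hT : IsSelfAdjoint T)
    {c r u : ℝ} (hc : 0 < c) (hc' : c ≤ 1) (hr : r ≤ 1 - c) :
    coshConj T K (c * u) + (1 - c) • (coshConj T K (c * u) - coshConj T K 0)
      + r • (coshConj T K (c * u) + coshConj T K 0 - (2 : ℝ) • coshConj T K (-(c * u / 2)))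
      ≤ coshConj T K u := by
  set C : ℝ → 𝔸 := fun v => cfc (fun x : ℝ => Real.cosh (v * x)) K with hC
  have key : C (c * u) + (1 - c) • (C (c * u) - C 0)
      + r • (C (c * u) + C 0 - (2 : ℝ) • C (-(c * u / 2))) ≤ C u := by
    simp only [hC]
    rw [← cfc_sub .., ← cfc_smul .., ← cfc_add .., ← cfc_add .., ← cfc_smul .., ← cfc_sub ..,
      ← cfc_smul .., ← cfc_add ..]
    refine cfc_mono fun x _ => ?_
    have h := cosh_refined (u := u * x) hc hc' hr
    have e1 : c * (u * x) = c * u * x := by ring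
    have e2 : c * u * x / 2 = c * u / 2 * x := by ring
    rw [e1, e2] at h
    simpa [smul_eq_mul] using h
  have hT' : IsSelfAdjoint (exp T) := hT.exp
  have h := hT'.conjugate_le_conjugate key
  refine (le_of_eq ?_).trans h
  simp only [coshConj, hC, mul_add, add_mul, mul_sub, sub_mul, mul_smul_comm, smul_mul_assoc]

end Exponential

/-! ### Tensor products of operators and the Hadamard product. -/

section HilbertTensor

variable {H : Type*} [NormedAddCommGroup H] [InnerProductSpace ℂ H]

theorem hilbertTensor_ext {S T : HilbertTensor H →L[ℂ] HilbertTensor H}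
    (h : ∀ x y, S (tmul x y) = T (tmul x y)) : S = T := by
  ext z
  induction z using UniformSpace.Completion.induction_on with
  | hp => exact isClosed_eq S.continuous T.continuous
  | ih z =>
    induction z using TensorProduct.induction_on with
    | zero => rw [UniformSpace.Completion.coe_zero, map_zero, map_zero]
    | tmul x y => exact h x y
    | add a b ha hb => rw [UniformSpace.Completion.coe_add, map_add, map_add, ha, hb]

theorem opTensor_coe (A B : H →L[ℂ] H) (z : H ⊗[ℂ] H) :
    opTensor A B (z : HilbertTensor H) = (TensorProduct.mapL A B z : H ⊗[ℂ] H) := by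
  simp [opTensor]

theorem tmul_add (x y z : H) : tmul x (y + z) = tmul x y + tmul x z := by
  simp [tmul, TensorProduct.tmul_add, UniformSpace.Completion.coe_add]

theorem add_tmul (x y z : H) : tmul (x + y) z = tmul x z + tmul y z := by
  simp [tmul, TensorProduct.add_tmul, UniformSpace.Completion.coe_add]

theorem smul_tmul (c : ℂ) (x y : H) : tmul (c • x) y = c • tmul x y := by
  rw [tmul, ← TensorProduct.smul_tmul', UniformSpace.Completion.coe_smul, tmul]

theorem tmul_smul (c : ℂ) (x y : H) : tmul x (c • y) = c • tmul x y := by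
  rw [tmul, TensorProduct.tmul_smul, UniformSpace.Completion.coe_smul, tmul]

theorem inner_tmul (x y x' y' : H) :
    inner ℂ (tmul x y) (tmul x' y') = inner ℂ x x' * inner ℂ y y' := by
  simp [tmul]

theorem opTensor_mul (A B C D : H →L[ℂ] H) :
    opTensor (A * B) (C * D) = opTensor A C * opTensor B D :=
  hilbertTensor_ext fun x y => by simp [opTensor_tmul]

theorem opTensor_one : opTensor (1 : H →L[ℂ] H) 1 = 1 :=
  hilbertTensor_ext fun x y => by simp [opTensor_tmul]

instance : IsTopologicalRing (HilbertTensor H →L[ℂ] HilbertTensor H) :=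
  NonUnitalSeminormedRing.toIsTopologicalRing
    (α := HilbertTensor H →L[ℂ] HilbertTensor H)

/-- The bilinear map `(A, B) ↦ A ⊗ B`. -/
def opTensorₗ :
    (H →L[ℂ] H) →ₗ[ℂ] (H →L[ℂ] H) →ₗ[ℂ] (HilbertTensor H →L[ℂ] HilbertTensor H) :=
  LinearMap.mk₂ ℂ opTensor
    (fun _ _ _ => hilbertTensor_ext fun x y => by simp [opTensor_tmul, add_tmul])
    (fun _ _ _ => hilbertTensor_ext fun x y => by simp [opTensor_tmul, smul_tmul])
    (fun _ _ _ => hilbertTensor_ext fun x y => by simp [opTensor_tmul, tmul_add])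
    (fun _ _ _ => hilbertTensor_ext fun x y => by simp [opTensor_tmul, tmul_smul])

theorem norm_opTensor_le (A B : H →L[ℂ] H) : ‖opTensor A B‖ ≤ ‖A‖ * ‖B‖ := by
  refine ContinuousLinearMap.opNorm_le_bound _ (by positivity) fun z => ?_
  induction z using UniformSpace.Completion.induction_on with
  | hp => exact isClosed_le (by fun_prop) (by fun_prop)
  | ih z =>
    rw [opTensor_coe, UniformSpace.Completion.norm_coe, UniformSpace.Completion.norm_coe]
    exact (TensorProduct.mapL A B).le_of_opNorm_le (TensorProduct.norm_mapL_le A B) z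

/-- The homomorphism `A ↦ A ⊗ 1`. -/
def opTensorLeft : (H →L[ℂ] H) →+* (HilbertTensor H →L[ℂ] HilbertTensor H) where
  toFun A := opTensor A 1
  map_one' := opTensor_one
  map_mul' A B := by rw [← opTensor_mul, one_mul]
  map_zero' := (opTensorₗ.flip 1).map_zero
  map_add' := (opTensorₗ.flip 1).map_add

/-- The homomorphism `A ↦ 1 ⊗ A`. -/
def opTensorRight : (H →L[ℂ] H) →+* (HilbertTensor H →L[ℂ] HilbertTensor H) where
  toFun A := opTensor 1 A
  map_one' := opTensor_one
  map_mul' A B := by rw [← opTensor_mul, one_mul]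
  map_zero' := (opTensorₗ 1).map_zero
  map_add' := (opTensorₗ 1).map_add

theorem continuous_opTensorLeft : Continuous (opTensorLeft (H := H)) :=
  AddMonoidHomClass.continuous_of_bound opTensorLeft ‖(1 : H →L[ℂ] H)‖
    fun A => by rw [mul_comm]; exact norm_opTensor_le A 1

theorem continuous_opTensorRight : Continuous (opTensorRight (H := H)) :=
  AddMonoidHomClass.continuous_of_bound opTensorRight ‖(1 : H →L[ℂ] H)‖
    fun A => norm_opTensor_le 1 A

theorem commute_opTensor_one (A B : H →L[ℂ] H) : Commute (opTensor A 1) (opTensor 1 B) := by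
  rw [commute_iff_eq, ← opTensor_mul, ← opTensor_mul]; simp

variable [CompleteSpace H]

theorem star_opTensor (A B : H →L[ℂ] H) : star (opTensor A B) = opTensor (star A) (star B) := by
  refine hilbertTensor_ext fun x y => ?_
  refine ext_inner_right ℂ fun z => ?_
  rw [ContinuousLinearMap.star_eq_adjoint, ContinuousLinearMap.adjoint_inner_left]
  induction z using UniformSpace.Completion.induction_on with
  | hp => exact isClosed_eq (by fun_prop) (by fun_prop)
  | ih z =>
    induction z using TensorProduct.induction_on with
    | zero => rw [UniformSpace.Completion.coe_zero, map_zero, inner_zero_right, inner_zero_right]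
    | tmul x' y' =>
      change inner ℂ (tmul x y) (opTensor A B (tmul x' y')) = inner ℂ _ (tmul x' y')
      simp only [opTensor_tmul, inner_tmul, ContinuousLinearMap.star_eq_adjoint,
        ContinuousLinearMap.adjoint_inner_left]
    | add a b ha hb =>
      rw [UniformSpace.Completion.coe_add, map_add, inner_add_right, inner_add_right, ha, hb]

theorem opTensor_exp (L M : H →L[ℂ] H) :
    opTensor (exp L) (exp M) = exp (opTensor L 1 + opTensor 1 M) := by
  have h : opTensor (exp L) 1 * opTensor 1 (exp M) = exp (opTensor L 1 + opTensor 1 M) :=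
    exp_add_of_commute_map (𝔸 := H →L[ℂ] H) (𝔹 := HilbertTensor H →L[ℂ] HilbertTensor H)
      (f := opTensorLeft) (g := opTensorRight)
      continuous_opTensorLeft continuous_opTensorRight (commute_opTensor_one L M)
  rw [← h, ← opTensor_mul, mul_one, one_mul]

/-- In the basis `e` the product is entrywise: its `(i, j)` entry is the product of those of `A` and
`B`. -/
theorem hadamard_comm {ι : Type*} (e : HilbertBasis ι ℂ H) (A B : H →L[ℂ] H) :
    hadamard e A B = hadamard e B A := by
  have hon : Dense (Submodule.span ℂ (Set.range e) : Set H) :=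
    Submodule.dense_iff_topologicalClosure_eq_top.mpr e.dense_span
  refine ContinuousLinearMap.ext_on hon ?_
  rintro _ ⟨j, rfl⟩
  refine e.repr.injective (lp.ext (funext fun i => ?_))
  simp only [HilbertBasis.repr_apply_apply, hadamard, ContinuousLinearMap.comp_apply,
    ContinuousLinearMap.adjoint_inner_right, LinearIsometry.coe_toContinuousLinearMap,
    diagIsometry_apply_basis, opTensor_tmul, inner_tmul]
  exact mul_comm _ _

end HilbertTensor
-- Real powers as exponentials of logarithms.
theorem rpow_eq_exp_smul_log {𝔸 : Type*} [CStarAlgebra 𝔸] [PartialOrder 𝔸] [StarOrderedRing 𝔸]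
    {a : 𝔸} (ha : IsStrictlyPositive a) (p : ℝ) : a ^ p = exp (p • CFC.log a) := by
  have hne : ∀ x ∈ spectrum ℝ a, x ≠ 0 := by grind
  rw [exp_smul_eq_cfc .log, CFC.rpow_eq_cfc_real ha.nonneg, CFC.log,
    ← cfc_comp' (fun x : ℝ => Real.exp (p * x)) Real.log a (by fun_prop)
      (by fun_prop (disch := assumption))]
  refine cfc_congr fun x hx => ?_
  have hx0 : 0 < x := lt_of_le_of_ne (spectrum_nonneg_of_nonneg ha.nonneg hx) (hne x hx).symm
  rw [Real.rpow_def_of_pos hx0, mul_comm]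

/-- `p L + (1 - p) M = (L + M)/2 + (p - 1/2)(L - M)`; the factor `1/4` splits `(L + M)/2` evenly
between the two sides. -/
theorem exp_smul_add_smul_symm {𝔸 : Type*} [CStarAlgebra 𝔸] {L M : 𝔸} (hL : IsSelfAdjoint L)
    (hM : IsSelfAdjoint M) (h : Commute L M) (p : ℝ) :
    exp (p • L + (1 - p) • M) + exp ((1 - p) • L + p • M) =
      (2 : ℝ) • coshConj ((1 / 4 : ℝ) • (L + M)) (L - M) (p - 1 / 2) := by
  have hTK : Commute ((1 / 4 : ℝ) • (L + M)) (L - M) :=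
    (((Commute.refl L).sub_right h).add_left (h.symm.sub_right (Commute.refl M))).smul_left _
  rw [← exp_add_exp_eq_coshConj (hL.sub hM) hTK]
  congr 2 <;> module

/-! ### Order-preserving compressions. -/

section Conjugation

variable {E F : Type*} [NormedAddCommGroup E] [InnerProductSpace ℂ E] [CompleteSpace E]
  [NormedAddCommGroup F] [InnerProductSpace ℂ F] [CompleteSpace F]

/-- The map `Z ↦ V* Z V` on bounded operators. -/
def adjointConj (V : E →L[ℂ] F) : (F →L[ℂ] F) →ₗ[ℝ] (E →L[ℂ] E) where
  toFun Z := V.adjoint ∘L Z ∘L V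
  map_add' Y Z := by ext; simp
  map_smul' c Z := by
    ext x
    change V.adjoint (c • Z (V x)) = c • V.adjoint (Z (V x))
    exact map_real_smul V.adjoint V.adjoint.continuous c _

theorem adjointConj_mono (V : E →L[ℂ] F) {Y Z : F →L[ℂ] F} (h : Y ≤ Z) :
    adjointConj V Y ≤ adjointConj V Z := by
  rw [ContinuousLinearMap.le_def] at h ⊢
  rw [← map_sub]
  exact h.adjoint_conj V

theorem adjointConj_comp (P : F →L[ℂ] F) (V : E →L[ℂ] F) (Z : F →L[ℂ] F) :
    adjointConj (P ∘L V) Z = adjointConj V (star P * Z * P) := by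
  ext x
  simp [adjointConj, ContinuousLinearMap.adjoint_comp, ContinuousLinearMap.star_eq_adjoint]

end Conjugation

/-! ### Hadamard products of weighted means as compressed `cosh` terms. -/

variable {H : Type*} [NormedAddCommGroup H] [InnerProductSpace ℂ H] [CompleteSpace H]

/-- The operator `A^(-1/2) B A^(-1/2)`. -/
def relativeOp (A B : H →L[ℂ] H) : H →L[ℂ] H := A ^ (-(1 / 2) : ℝ) * B * A ^ (-(1 / 2) : ℝ)

theorem isStrictlyPositive_relativeOp {A B : H →L[ℂ] H} (hA : IsStrictlyPositive A)
    (hB : IsStrictlyPositive B) : IsStrictlyPositive (relativeOp A B) := by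
  have h := hA.rpow A (-(1 / 2))
  refine IsUnit.isStrictlyPositive ((h.isUnit.mul hB.isUnit).mul h.isUnit) ?_
  exact conjugate_nonneg_of_nonneg hB.nonneg h.nonneg

/-- The operator `(A^(1/2) ⊗ A'^(1/2)) U`. -/
def diagFactor {ι : Type*} (e : HilbertBasis ι ℂ H) (A A' : H →L[ℂ] H) : H →L[ℂ] HilbertTensor H :=
  opTensor (A ^ (1 / 2 : ℝ)) (A' ^ (1 / 2 : ℝ)) ∘L (diagIsometry e).toContinuousLinearMap

theorem hadamard_wgmean {ι : Type*} (e : HilbertBasis ι ℂ H) (A B A' B' : H →L[ℂ] H) (p q : ℝ) :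
    hadamard e (wgmean p A B) (wgmean q A' B') =
      adjointConj (diagFactor e A A') (opTensor (relativeOp A B ^ p) (relativeOp A' B' ^ q)) := by
  have hsa (C : H →L[ℂ] H) : star (C ^ (1 / 2 : ℝ)) = C ^ (1 / 2 : ℝ) :=
    (IsSelfAdjoint.of_nonneg CFC.rpow_nonneg).star_eq
  have h (C D : H →L[ℂ] H) : hadamard e C D =
      adjointConj (diagIsometry e).toContinuousLinearMap (opTensor C D) := rfl
  rw [h, diagFactor, adjointConj_comp, star_opTensor, hsa, hsa, wgmean, wgmean, opTensor_mul,
    opTensor_mul, relativeOp, relativeOp]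

/-- The sum of hyperbolic cosines appearing after symmetrising `X ^ p ⊗ Y ^ (1 - p)`. -/
def tensorCosh (X Y : H →L[ℂ] H) (v : ℝ) : HilbertTensor H →L[ℂ] HilbertTensor H :=
  coshConj ((1 / 4 : ℝ) • (opTensor (CFC.log X) 1 + opTensor 1 (CFC.log Y)))
    (opTensor (CFC.log X) 1 - opTensor 1 (CFC.log Y)) v

omit [CompleteSpace H] in
theorem opTensor_real_smul_left (c : ℝ) (A B : H →L[ℂ] H) :
    opTensor (c • A) B = c • opTensor A B :=
  (opTensorₗ.flip B).map_smul_of_tower c A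

omit [CompleteSpace H] in
theorem opTensor_real_smul_right (c : ℝ) (A B : H →L[ℂ] H) :
    opTensor A (c • B) = c • opTensor A B :=
  (opTensorₗ A).map_smul_of_tower c B

theorem isSelfAdjoint_opTensor {A B : H →L[ℂ] H} (hA : IsSelfAdjoint A) (hB : IsSelfAdjoint B) :
    IsSelfAdjoint (opTensor A B) := by
  rw [IsSelfAdjoint, star_opTensor, hA.star_eq, hB.star_eq]

theorem opTensor_rpow_add_eq_tensorCosh {X Y : H →L[ℂ] H} (hX : IsStrictlyPositive X)
    (hY : IsStrictlyPositive Y) (p : ℝ) :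
    opTensor (X ^ p) (Y ^ (1 - p)) + opTensor (X ^ (1 - p)) (Y ^ p) =
      (2 : ℝ) • tensorCosh X Y (p - 1 / 2) := by
  set L := opTensor (CFC.log X) 1 with hL
  set M := opTensor 1 (CFC.log Y) with hM
  have hLM : Commute L M := commute_opTensor_one _ _
  have hLsa : IsSelfAdjoint L := isSelfAdjoint_opTensor .log (.one _)
  have hMsa : IsSelfAdjoint M := isSelfAdjoint_opTensor (.one _) .log
  have hpow (q r : ℝ) : opTensor (X ^ q) (Y ^ r) = exp (q • L + r • M) := by
    rw [rpow_eq_exp_smul_log hX, rpow_eq_exp_smul_log hY, opTensor_exp, opTensor_real_smul_left,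
      opTensor_real_smul_right]
  rw [hpow, hpow]
  exact exp_smul_add_smul_symm (𝔸 := HilbertTensor H →L[ℂ] HilbertTensor H) hLsa hMsa hLM p

variable {ι : Type*} (e : HilbertBasis ι ℂ H) {n : ℕ} (A B : Fin n → H →L[ℂ] H)

theorem hadamard_sum {m : ℕ} (X : Fin n → H →L[ℂ] H) (Y : Fin m → H →L[ℂ] H) :
    hadamard e (∑ j, X j) (∑ k, Y k) = ∑ j, ∑ k, hadamard e (X j) (Y k) := by
  have h (C D : H →L[ℂ] H) : hadamard e C D =
      adjointConj (diagIsometry e).toContinuousLinearMap (opTensorₗ C D) := rfl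
  simp only [h, map_sum, LinearMap.sum_apply]
  exact Finset.sum_comm

theorem hadamard_sum_wgmean (hA : ∀ j, IsStrictlyPositive (A j))
    (hB : ∀ j, IsStrictlyPositive (B j)) (p : ℝ) :
    hadamard e (∑ j, wgmean p (A j) (B j)) (∑ j, wgmean (1 - p) (A j) (B j)) =
      ∑ j, ∑ k, adjointConj (diagFactor e (A j) (A k))
        (tensorCosh (relativeOp (A j) (B j)) (relativeOp (A k) (B k)) (p - 1 / 2)) := by
  have hX j := isStrictlyPositive_relativeOp (hA j) (hB j)
  have h₁ := hadamard_sum e (fun j => wgmean p (A j) (B j)) (fun j => wgmean (1 - p) (A j) (B j))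
  have h₂ := hadamard_sum e (fun j => wgmean (1 - p) (A j) (B j)) (fun j => wgmean p (A j) (B j))
  rw [hadamard_comm] at h₂
  -- Both expansions have the same left side, so adding them doubles it and symmetrises each term in
  -- `p ↔ 1 - p`.
  have htwo := congrArg₂ (· + ·) h₁ h₂
  simp only [← Finset.sum_add_distrib, hadamard_wgmean, ← map_add,
    opTensor_rpow_add_eq_tensorCosh (hX _) (hX _), map_smul, ← Finset.smul_sum] at htwo
  rw [← two_smul ℝ] at htwo
  exact smul_right_injective _ (two_ne_zero (α := ℝ)) htwo

theorem tensorCosh_refined (X Y : H →L[ℂ] H) {c r u : ℝ} (hc : 0 < c) (hc' : c ≤ 1)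
    (hr : r ≤ 1 - c) :
    tensorCosh X Y (c * u) + (1 - c) • (tensorCosh X Y (c * u) - tensorCosh X Y 0)
      + r • (tensorCosh X Y (c * u) + tensorCosh X Y 0
        - (2 : ℝ) • tensorCosh X Y (-(c * u / 2))) ≤ tensorCosh X Y u := by
  have hLsa : IsSelfAdjoint (opTensor (CFC.log X) 1) := isSelfAdjoint_opTensor .log (.one _)
  have hMsa : IsSelfAdjoint (opTensor 1 (CFC.log Y)) := isSelfAdjoint_opTensor (.one _) .log
  exact coshConj_refined ((IsSelfAdjoint.all (1 / 4 : ℝ)).smul (hLsa.add hMsa)) hc hc' hr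

end Callebaut

end

/-- The order on operators is the Loewner order, and `IsStrictlyPositive` means positive and
invertible. -/
theorem theorem2p8 {H : Type*} [NormedAddCommGroup H] [InnerProductSpace ℂ H] [CompleteSpace H]
    {ι : Type*} (e : HilbertBasis ι ℂ H) {n : ℕ} (A B : Fin n → H →L[ℂ] H)
    (hA : ∀ j, IsStrictlyPositive (A j)) (hB : ∀ j, IsStrictlyPositive (B j))
    (s t r' : ℝ) (hst : (1 / 2 < s ∧ s ≤ t ∧ t ≤ 1) ∨ (0 ≤ t ∧ t ≤ s ∧ s < 1 / 2))
    (hr' : r' = min ((t - s) / (t - 1 / 2)) ((s - 1 / 2) / (t - 1 / 2))) :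
    Callebaut.hadamard e (∑ j, Callebaut.wgmean s (A j) (B j))
        (∑ j, Callebaut.wgmean (1 - s) (A j) (B j))
      + ((t - s) / (t - 1 / 2)) •
        (Callebaut.hadamard e (∑ j, Callebaut.wgmean s (A j) (B j))
            (∑ j, Callebaut.wgmean (1 - s) (A j) (B j))
          - Callebaut.hadamard e (∑ j, Callebaut.gmean (A j) (B j))
            (∑ j, Callebaut.gmean (A j) (B j)))
      + r' •
        (Callebaut.hadamard e (∑ j, Callebaut.wgmean s (A j) (B j))
            (∑ j, Callebaut.wgmean (1 - s) (A j) (B j))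
          + Callebaut.hadamard e (∑ j, Callebaut.gmean (A j) (B j))
            (∑ j, Callebaut.gmean (A j) (B j))
          - (2 : ℝ) • Callebaut.hadamard e
              (∑ j, Callebaut.wgmean ((3 - 2 * s) / 4) (A j) (B j))
              (∑ j, Callebaut.wgmean ((1 + 2 * s) / 4) (A j) (B j)))
      ≤ Callebaut.hadamard e (∑ j, Callebaut.wgmean t (A j) (B j))
          (∑ j, Callebaut.wgmean (1 - t) (A j) (B j)) := by
  obtain ⟨c, hc⟩ : ∃ c, c = (s - 1 / 2) / (t - 1 / 2) := ⟨_, rfl⟩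
  have ht : t - 1 / 2 ≠ 0 := by
    rcases hst with h | h
    · exact (by linarith [h.1, h.2.1] : 0 < t - 1 / 2).ne'
    · exact (by linarith [h.2.1, h.2.2] : t - 1 / 2 < 0).ne
  have hcs : s - 1 / 2 = c * (t - 1 / 2) := by rw [hc, div_mul_cancel₀ _ ht]
  have hν : (t - s) / (t - 1 / 2) = 1 - c := by 
    rw [hc, eq_sub_iff_add_eq, ← add_div, div_eq_one_iff_eq ht]; ring
  have hc0 : 0 < c := by
    rw [hc]
    rcases hst with h | h
    · exact div_pos (by linarith) (by linarith)
    · exact div_pos_of_neg_of_neg (by linarith) (by linarith)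
  have hν0 : 0 ≤ 1 - c := by
    rw [← hν]
    rcases hst with h | h
    · exact div_nonneg (by linarith) (by linarith)
    · exact div_nonneg_of_nonpos (by linarith) (by linarith)
  have hr : r' ≤ 1 - c := by rw [hr', hν]; exact min_le_left _ _
  have hQ := Callebaut.hadamard_sum_wgmean e A B hA hB
  have hmid := hQ ((3 - 2 * s) / 4)
  have hhalf := hQ (1 / 2)
  -- The weight `(3 - 2s)/4` is the reflection in `1/2` of the midpoint of `s` and `1/2`, hence the
  -- argument `-(c * u / 2)` with `u = t - 1/2`.
  rw [show (1 : ℝ) - (3 - 2 * s) / 4 = (1 + 2 * s) / 4 by ring,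
    show (3 - 2 * s) / 4 - 1 / 2 = -(c * (t - 1 / 2) / 2) by rw [← hcs]; ring] at hmid
  rw [show (1 : ℝ) - 1 / 2 = 1 / 2 by norm_num, sub_self] at hhalf
  simp only [Callebaut.gmean]
  rw [hQ s, hQ t, hmid, hhalf, hν, hcs]
  have h := Finset.sum_le_sum fun j (_ : j ∈ Finset.univ) =>
    Finset.sum_le_sum fun k (_ : k ∈ Finset.univ) =>
      Callebaut.adjointConj_mono (Callebaut.diagFactor e (A j) (A k))
        (Callebaut.tensorCosh_refined (Callebaut.relativeOp (A j) (B j))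
          (Callebaut.relativeOp (A k) (B k)) (u := t - 1 / 2) hc0 (by linarith) hr)
  refine (le_of_eq ?_).trans h
  simp only [map_add, map_sub, map_smul, Finset.sum_add_distrib, Finset.sum_sub_distrib,
    ← Finset.smul_sum]
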